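/- Let $c\in\mathbf{R}$, $c\neq 0$. Consider the following two Monge--Ampère systems, each generated by a contact form $\theta$ and a 2-form $\omega$ on a 5-dimensional manifold $M$. ($\mathrm{Hess}=c$) $M=\mathbf{R}^5$ with coordinates $(x,y,z,p,q)$, $\theta=dz-p\,dx-q\,dy$, $\omega=c\,dx\wedge dy-dp\wedge dq$. ($K=c$) $M=\mathbf{R}^3\times S^2\subset\mathbf{R}^3\times\mathbf{R}^3$ with coordinates $(x_1,x_2,x_3;y_1,y_2,y_3)$, $\theta=y_1dx_1+y_2dx_2+y_3dx_3$ and $\omega=c(y_1dx_2\wedge dx_3+y_2dx_3\wedge dx_1+y_3dx_1\wedge dx_2)-(y_1dy_2\wedge dy_3+y_2dy_3\wedge dy_1+y_3dy_1\wedge dy_2)$. A $C^\infty$ map-germ $f$ from $(\mathbf{R}^2,0)$ to $M$ (with arbitrary base point $f(0)$, not necessarily an immersion) is called an integral map-germ if $f^*\theta=0$, and a generalized geometric solution if $f^*\theta=0$ and $f^*\omega=0$. An integral map-germ $f$ is called an open umbrella if it is contactomorphic to $$g(u,v)=(x,y,z,p,q)=\left(u,\;v^2,\;uv^3,\;v^3,\;\tfrac32uv\right)$$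 in $\mathbf{R}^5$ with the contact structure $\{dz-p\,dx-q\,dy=0\}$, that is, if there are a germ of diffeomorphism $\sigma:(\mathbf{R}^2,0)\to(\mathbf{R}^2,0)$ and a germ of contactomorphism $\Phi:(M,f(0))\to(\mathbf{R}^5,0)$ with $\Phi\circ f=g\circ\sigma$. Then an open umbrella $f:(\mathbf{R}^2,0)\to M$ is never a generalized geometric solution to $\mathrm{Hess}=c$ (in the case $M=\mathbf{R}^5$), nor to $K=c$ (in the case $M=\mathbf{R}^3\times S^2$). -/

import Mathlib

open scoped Manifold ContDiff Topology

namespace MongeAmpere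

noncomputable section

/-- The source plane `ℝ²`, with coordinates `(u, v) = (w 0, w 1)`. -/
abbrev Plane : Type := EuclideanSpace ℝ (Fin 2)

/-- The space `ℝ⁵`, with coordinates `(x, y, z, p, q) = (P 0, P 1, P 2, P 3, P 4)`. -/
abbrev R5 : Type := EuclideanSpace ℝ (Fin 5)

section General

variable {E : Type*} [NormedAddCommGroup E] [NormedSpace ℝ E]
  {H : Type*} [TopologicalSpace H] (I : ModelWithCorners ℝ E H)
  {M : Type*} [TopologicalSpace M] [ChartedSpace H M]

/-- The wedge product `α ∧ β` of two covectors at a point. -/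
def wedge {m : M} (α β : TangentSpace I m →L[ℝ] ℝ) (v w : TangentSpace I m) : ℝ :=
  α v * β w - α w * β v

/-- `f` represents a `C^∞` map-germ at `0`. -/
def IsSmoothGerm (f : Plane → M) : Prop :=
  ∀ᶠ a in 𝓝 (0 : Plane), ContMDiffAt 𝓘(ℝ, Plane) I ∞ f a

/-- `f` represents an integral map-germ `(ℝ², 0) → M` of the distribution `ker θ`:
it is smooth and `f^*θ = 0` near `0`. -/
def IsIntegralGerm (θ : (m : M) → TangentSpace I m →L[ℝ] ℝ) (f : Plane → M) : Prop :=
  IsSmoothGerm I f ∧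
    ∀ᶠ a in 𝓝 (0 : Plane), ∀ v : TangentSpace 𝓘(ℝ, Plane) a,
      θ (f a) (mfderiv 𝓘(ℝ, Plane) I f a v) = 0

/-- `f` represents a germ of generalized geometric solution (not necessarily an immersion) of the
Monge-Ampère system generated by the contact form `θ` and the 2-form `Ω`:
it is smooth, and `f^*θ = 0` and `f^*Ω = 0` near `0`. -/
def IsGeneralizedGeometricSolution (θ : (m : M) → TangentSpace I m →L[ℝ] ℝ)
    (Ω : (m : M) → TangentSpace I m → TangentSpace I m → ℝ) (f : Plane → M) : Prop :=
  IsIntegralGerm I θ f ∧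
    ∀ᶠ a in 𝓝 (0 : Plane), ∀ v w : TangentSpace 𝓘(ℝ, Plane) a,
      Ω (f a) (mfderiv 𝓘(ℝ, Plane) I f a v) (mfderiv 𝓘(ℝ, Plane) I f a w) = 0

/-- `Φ` represents a contactomorphism-germ at `m₀` from `(M, ker θ)` to `(M', ker θ')`: a germ of
`C^∞` diffeomorphism whose differential maps one contact distribution onto the other. -/
def IsContactomorphismAt
    {E' : Type*} [NormedAddCommGroup E'] [NormedSpace ℝ E']
    {H' : Type*} [TopologicalSpace H'] (I' : ModelWithCorners ℝ E' H')
    {M' : Type*} [TopologicalSpace M'] [ChartedSpace H' M']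
    (θ : (m : M) → TangentSpace I m →L[ℝ] ℝ) (θ' : (m : M') → TangentSpace I' m →L[ℝ] ℝ)
    (Φ : M → M') (m₀ : M) : Prop :=
  IsLocalDiffeomorphAt I I' ∞ Φ m₀ ∧
    ∀ᶠ m in 𝓝 m₀, ∀ v : TangentSpace I m,
      θ' (Φ m) (mfderiv I I' Φ m v) = 0 ↔ θ m v = 0

end General

/-- The differential `dP_i` of the `i`-th coordinate of `ℝ⁵`, at the point `P`. -/
def dR5 (i : Fin 5) (P : R5) : TangentSpace 𝓘(ℝ, R5) P →L[ℝ] ℝ :=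
  mvfderiv 𝓘(ℝ, R5) (fun Q : R5 => Q i) P

/-- The contact form `θ = dz - p dx - q dy` on `ℝ⁵`. -/
def thetaR5 (P : R5) : TangentSpace 𝓘(ℝ, R5) P →L[ℝ] ℝ :=
  dR5 2 P - P 3 • dR5 0 P - P 4 • dR5 1 P

/-- The 2-form `ω = c dx ∧ dy - dp ∧ dq` on `ℝ⁵` of the equation `Hess = c`. -/
def omegaHess (c : ℝ) (P : R5) (v w : TangentSpace 𝓘(ℝ, R5) P) : ℝ :=
  c * wedge _ (dR5 0 P) (dR5 1 P) v w - wedge _ (dR5 3 P) (dR5 4 P) v w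

/-- The unit tangent bundle `ℝ³ × S²` of Euclidean space, with points `(x, y)`, `|y| = 1`. -/
abbrev UnitTangent : Type :=
  EuclideanSpace ℝ (Fin 3) × Metric.sphere (0 : EuclideanSpace ℝ (Fin 3)) 1

/-- The model with corners of the 5-dimensional manifold `ℝ³ × S²`. -/
abbrev modelUT := (𝓡 3).prod (𝓡 2)

/-- The differential at `m` of the coordinate function `x_i` on `ℝ³ × S²`. -/
def dX (i : Fin 3) (m : UnitTangent) : TangentSpace modelUT m →L[ℝ] ℝ :=
  mvfderiv modelUT (fun n : UnitTangent => n.1 i) m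

/-- The differential at `m` of the coordinate function `y_i` restricted to `ℝ³ × S²`. -/
def dY (i : Fin 3) (m : UnitTangent) : TangentSpace modelUT m →L[ℝ] ℝ :=
  mvfderiv modelUT (fun n : UnitTangent => n.2.1 i) m

/-- The contact form `θ = y₁ dx₁ + y₂ dx₂ + y₃ dx₃` on `ℝ³ × S²`. -/
def thetaUT (m : UnitTangent) : TangentSpace modelUT m →L[ℝ] ℝ :=
  m.2.1 0 • dX 0 m + m.2.1 1 • dX 1 m + m.2.1 2 • dX 2 m

/-- The 2-form of the equation `K = c` on `ℝ³ × S²`: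
`c (y₁ dx₂ ∧ dx₃ + y₂ dx₃ ∧ dx₁ + y₃ dx₁ ∧ dx₂) - (y₁ dy₂ ∧ dy₃ + y₂ dy₃ ∧ dy₁ + y₃ dy₁ ∧ dy₂)`. -/
def omegaK (c : ℝ) (m : UnitTangent) (v w : TangentSpace modelUT m) : ℝ :=
  c * (m.2.1 0 * wedge _ (dX 1 m) (dX 2 m) v w + m.2.1 1 * wedge _ (dX 2 m) (dX 0 m) v w
      + m.2.1 2 * wedge _ (dX 0 m) (dX 1 m) v w)
    - (m.2.1 0 * wedge _ (dY 1 m) (dY 2 m) v w + m.2.1 1 * wedge _ (dY 2 m) (dY 0 m) v w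
      + m.2.1 2 * wedge _ (dY 0 m) (dY 1 m) v w)

/-- The normal form `(u, v) ↦ (u, v², u v³, v³, (3/2) u v)` of the open umbrella. -/
def umbrella (a : Plane) : R5 :=
  !₂[a 0, a 1 ^ 2, a 0 * a 1 ^ 3, a 1 ^ 3, 3 / 2 * (a 0 * a 1)]

/-- `f` represents an open umbrella germ `(ℝ², 0) → M`: an integral map-germ that is carried to the
normal form by a germ of diffeomorphism `σ` of `(ℝ², 0)` and a contactomorphism-germ `Φ` from
`(M, f 0)` to `(ℝ⁵, 0)`. -/
def IsOpenUmbrella {E : Type*} [NormedAddCommGroup E] [NormedSpace ℝ E]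
    {H : Type*} [TopologicalSpace H] (I : ModelWithCorners ℝ E H)
    {M : Type*} [TopologicalSpace M] [ChartedSpace H M]
    (θ : (m : M) → TangentSpace I m →L[ℝ] ℝ) (f : Plane → M) : Prop :=
  IsIntegralGerm I θ f ∧
    ∃ (σ : Plane → Plane) (Φ : M → R5),
      IsLocalDiffeomorphAt 𝓘(ℝ, Plane) 𝓘(ℝ, Plane) ∞ σ 0 ∧ σ 0 = 0 ∧
      IsContactomorphismAt I 𝓘(ℝ, R5) θ thetaR5 Φ (f 0) ∧ Φ (f 0) = 0 ∧
      ∀ᶠ a in 𝓝 (0 : Plane), Φ (f a) = umbrella (σ a)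

end

end MongeAmpere

/-! Write `f` near the singular point as `G ∘ umbrella` up to reparametrisation, where `G` inverts
the contactomorphism, and put `E i = dG(e i)` at `0`. A solution makes both `ω` and `dθ` vanish on
all pairs of tangent images of `G ∘ umbrella`. At the singular point itself this says nothing, since
`∂_v` is zero there, but along each axis `∂_v` carries a scalar factor that can be divided out. In
the limit, and after one differentiation along the `v`-axis, each of the two forms `γ` satisfies
`γ(E 0, E 1) = 0`, `γ(E 0, E 4) = 0` and `γ(E 4, E 1) + γ(E 0, E 3) = 0`
(`pairing_eq_zero_of_umbrella`).

The vectors `E 0, E 1, E 3, E 4` form a basis of the contact hyperplane. On it `ω ∧ dθ = 0`;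
evaluated on this basis, the identity reduces to `ω(E 0, E 3) * dθ(E 0, E 3) = 0`. So `E 0` lies in
the kernel of `ω` or of `dθ`, although both are nondegenerate there: `dθ` by contactness, `ω`
because `c ≠ 0` (`not_linearIndependent_of_effective`). Both equations have the same normal form on
contact hyperplanes, so one argument serves for both. -/

namespace MongeAmpere

set_option maxSynthPendingDepth 3

/-! ### Linear algebra of an effective pair of 2-forms -/

/-- On `ℝ⁴`, with coordinates `(x, y, p, q)`, let `α = c dx ∧ dy - dp ∧ dq` and
`β = dp ∧ dx + dq ∧ dy`. No basis `(a, b, d, e)` satisfies, for both `γ = α` and `γ = β`,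
`γ(a, b) = 0`, `γ(a, e) = 0` and `γ(a, d) = γ(b, e)`: as `α ∧ β = 0`, the vector `a` would be in the
kernel of `α` or of `β`. -/
theorem not_linearIndependent_of_effective {c : ℝ} (hc : c ≠ 0) (a b d e : Fin 4 → ℝ)
    (α β : (Fin 4 → ℝ) → (Fin 4 → ℝ) → ℝ)
    (hα : ∀ v w, α v w = c * (v 0 * w 1 - w 0 * v 1) - (v 2 * w 3 - w 2 * v 3))
    (hβ : ∀ v w, β v w = (v 2 * w 0 - w 2 * v 0) + (v 3 * w 1 - w 3 * v 1))
    (hab : α a b = 0) (hae : α a e = 0) (had : α e b + α a d = 0)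
    (kab : β a b = 0) (kae : β a e = 0) (kad : β e b + β a d = 0) :
    ¬ LinearIndependent ℝ ![a, b, d, e] := by
  intro hli
  have hspan := hli.span_eq_top_of_card_eq_finrank' (by simp)
  have ha : a ≠ 0 := by simpa using hli.ne_zero 0
  have vanish : ∀ L : (Fin 4 → ℝ) →ₗ[ℝ] ℝ, L a = 0 → L b = 0 → L d = 0 → L e = 0 →
      ∀ v, L v = 0 := by
    intro L h1 h2 h3 h4
    have : L = 0 := by
      apply LinearMap.ext_on_range (v := ![a, b, d, e]) hspan
      intro i
      fin_cases i <;> simpa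
    simp [this]
  let Lα : (Fin 4 → ℝ) →ₗ[ℝ] ℝ :=
    { toFun := α a, map_add' := fun v w => by simp only [hα, Pi.add_apply]; ring,
      map_smul' := fun r v => by simp [hα]; ring }
  let Lβ : (Fin 4 → ℝ) →ₗ[ℝ] ℝ :=
    { toFun := β a, map_add' := fun v w => by simp only [hβ, Pi.add_apply]; ring,
      map_smul' := fun r v => by simp [hβ]; ring }
  -- This is `(α ∧ β)(a, b, d, e)`; every monomial of `α ∧ β` repeats one of the covectors `dx, dy,
  -- dp, dq`.
  have key : α a b * β d e - α a d * β b e + α a e * β b d + α b d * β a e - α b e * β a d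
      + α d e * β a b = 0 := by
    simp only [hα, hβ]; ring
  have eα : α b e = α a d := by
    have : α b e = - α e b := by simp only [hα]; ring
    linarith
  have eβ : β b e = β a d := by
    have : β b e = - β e b := by simp only [hβ]; ring
    linarith
  have hprod : α a d * β a d = 0 := by
    rw [hab, hae, kab, kae, eα, eβ] at key
    linarith
  have aα : Lα a = 0 := by change α a a = 0; rw [hα]; ring
  have aβ : Lβ a = 0 := by change β a a = 0; rw [hβ]; ring
  apply ha
  rcases mul_eq_zero.1 hprod with h | h
  -- `α(a, ·)` vanishes on a basis, hence everywhere; testing it on the standard basis recovers each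
  -- coordinate of `a`, two of them multiplied by `c`.
  · have hz := vanish Lα aα hab h hae
    have h0 : α a (Pi.single 1 1) = 0 := hz _
    have h1 : α a (Pi.single 0 1) = 0 := hz _
    have h2 : α a (Pi.single 3 1) = 0 := hz _
    have h3 : α a (Pi.single 2 1) = 0 := hz _
    simp [hα, hc] at h0 h1 h2 h3
    ext i; fin_cases i <;> simpa
  · have hz := vanish Lβ aβ kab h kae
    have h0 : β a (Pi.single 2 1) = 0 := hz _
    have h1 : β a (Pi.single 3 1) = 0 := hz _
    have h2 : β a (Pi.single 0 1) = 0 := hz _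
    have h3 : β a (Pi.single 1 1) = 0 := hz _
    simp [hβ] at h0 h1 h2 h3
    ext i; fin_cases i <;> simpa

/-! ### Pulled-back forms along the axes of the umbrella -/

section

variable {V : Type*} [NormedAddCommGroup V] [NormedSpace ℝ V]

/-- If `F^*θ = 0` near a point, then `F^*dθ = 0` near this point. -/
theorem eventually_pullback_extDeriv_eq_zero {U : Type*} [NormedAddCommGroup U] [NormedSpace ℝ U]
    {F : U → V} {x : U} (hF : ContDiffAt ℝ 2 F x) {θ : V → V →L[ℝ] ℝ} (hθ : Differentiable ℝ θ)
    (h : ∀ᶠ a in 𝓝 x, ∀ w, θ (F a) (fderiv ℝ F a w) = 0) :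
    ∀ᶠ a in 𝓝 x, ∀ v w, fderiv ℝ θ (F a) (fderiv ℝ F a v) (fderiv ℝ F a w)
      - fderiv ℝ θ (F a) (fderiv ℝ F a w) (fderiv ℝ F a v) = 0 := by
  filter_upwards [h.eventually_nhds, hF.eventually (by simp)] with a ha hFa v w
  have hd : HasFDerivAt F (fderiv ℝ F a) a := (hFa.differentiableAt (by simp)).hasFDerivAt
  have hd2 : HasFDerivAt (fderiv ℝ F) (fderiv ℝ (fderiv ℝ F) a) a :=
    ((hFa.fderiv_right (m := 1) (by norm_num)).differentiableAt (by simp)).hasFDerivAt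
  have hsymm : fderiv ℝ (fderiv ℝ F) a v w = fderiv ℝ (fderiv ℝ F) a w v :=
    (hFa.isSymmSndFDerivAt (by simp)) v w
  -- Differentiate `θ(F)(dF w) = 0` in the direction `v`. The second-derivative term is symmetric in
  -- `v, w` and disappears on antisymmetrising.
  have key : ∀ v w, θ (F a) (fderiv ℝ (fderiv ℝ F) a v w)
      + fderiv ℝ θ (F a) (fderiv ℝ F a v) (fderiv ℝ F a w) = 0 := by
    intro v w
    have h1 := (((hθ (F a)).hasFDerivAt.comp a hd).clm_apply
      (hd2.clm_apply (hasFDerivAt_const w a)))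
    have h2 : HasFDerivAt (fun b => θ (F b) (fderiv ℝ F b w)) (0 : U →L[ℝ] ℝ) a :=
      (hasFDerivAt_const (0 : ℝ) a).congr_of_eventuallyEq (by
        filter_upwards [ha] with b hb using hb w)
    have := congrArg (fun L => L v) (h1.unique h2)
    simpa using this
  have h1 := key v w
  have h2 := key w v
  rw [hsymm] at h1
  linarith

theorem contDiff_umbrella : ContDiff ℝ ∞ umbrella := by
  rw [contDiff_euclidean]
  intro i
  fin_cases i <;> simp [umbrella] <;> fun_prop

theorem fderiv_umbrella (b v : Plane) :
    fderiv ℝ umbrella b v = !₂[v 0, 2 * b 1 * v 1, v 0 * b 1 ^ 3 + 3 * b 0 * b 1 ^ 2 * v 1,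
      3 * b 1 ^ 2 * v 1, 3 / 2 * (v 0 * b 1 + b 0 * v 1)] := by
  have hd : DifferentiableAt ℝ umbrella b := contDiff_umbrella.differentiable (by simp) b
  have hc (i : Fin 5) : fderiv ℝ umbrella b v i = fderiv ℝ (fun a => umbrella a i) b v := by
    have := ((EuclideanSpace.proj (𝕜 := ℝ) i).hasFDerivAt.comp b hd.hasFDerivAt).fderiv
    exact (congrArg (fun L => L v) this).symm
  have p0 : HasFDerivAt (fun a : Plane => a 0) (EuclideanSpace.proj (𝕜 := ℝ) (0 : Fin 2)) b :=
    (EuclideanSpace.proj (𝕜 := ℝ) (0 : Fin 2)).hasFDerivAt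
  have p1 : HasFDerivAt (fun a : Plane => a 1) (EuclideanSpace.proj (𝕜 := ℝ) (1 : Fin 2)) b :=
    (EuclideanSpace.proj (𝕜 := ℝ) (1 : Fin 2)).hasFDerivAt
  ext i
  rw [hc]
  fin_cases i
  · simp [umbrella, p0.fderiv]
  · simp [umbrella, (p1.pow 2).fderiv]
  · have := (p0.mul (p1.pow 3)).fderiv
    simp only [Pi.mul_def] at this
    simp [umbrella, this]; ring
  · simp [umbrella, (p1.pow 3).fderiv]
  · have := ((p0.mul p1).const_mul (3 / 2)).fderiv
    simp only [Pi.mul_def] at this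
    simp [umbrella, this]; ring

/-- The conditions on the values at `G 0` of a bilinear form that vanishes on `G ∘ umbrella`,
found by differentiating along the two axes of the source plane. -/
theorem pairing_eq_zero_of_umbrella {G : R5 → V} (hG : ContDiffAt ℝ ∞ G 0)
    {β : V → V →L[ℝ] V →L[ℝ] ℝ} (hβ : Differentiable ℝ β)
    (h : ∀ᶠ b in 𝓝 (0 : Plane), ∀ v w, β (G (umbrella b)) (fderiv ℝ (G ∘ umbrella) b v)
      (fderiv ℝ (G ∘ umbrella) b w) = 0)
    (E : Fin 5 → V) (hE : ∀ i, E i = fderiv ℝ G 0 (EuclideanSpace.single i 1)) :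
    β (G 0) (E 0) (E 1) = 0 ∧ β (G 0) (E 0) (E 4) = 0 ∧
      β (G 0) (E 4) (E 1) + β (G 0) (E 0) (E 3) = 0 := by
  have hu0 : umbrella 0 = 0 := by ext i; fin_cases i <;> simp [umbrella]
  have hG2 : ContDiffAt ℝ 2 G 0 := hG.of_le (WithTop.coe_le_coe.2 le_top)
  have hGd : HasFDerivAt G (fderiv ℝ G 0) 0 := (hG2.differentiableAt (by simp)).hasFDerivAt
  have hGd2 : HasFDerivAt (fderiv ℝ G) (fderiv ℝ (fderiv ℝ G) 0) 0 :=
    ((hG2.fderiv_right (m := 1) (by norm_num)).differentiableAt (by simp)).hasFDerivAt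
  have hcont : Filter.Tendsto umbrella (𝓝 0) (𝓝 0) := by
    simpa [hu0] using contDiff_umbrella.continuous.tendsto 0
  have h' : ∀ᶠ b in 𝓝 (0 : Plane), ∀ v w,
      β (G (umbrella b)) (fderiv ℝ G (umbrella b) (fderiv ℝ umbrella b v))
        (fderiv ℝ G (umbrella b) (fderiv ℝ umbrella b w)) = 0 := by
    filter_upwards [h, hcont.eventually (hG2.eventually (by simp))] with b hb hGb v w
    have := hb v w
    rwa [fderiv_comp b (hGb.differentiableAt (by simp))
      (contDiff_umbrella.differentiable (by simp) b)] at this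
  -- the derivative of a pairing along a curve through `0`
  have along : ∀ (ℓ : ℝ → Plane) (γ' : R5) (X Y : ℝ → R5) (X' Y' : R5),
      Filter.Tendsto ℓ (𝓝 0) (𝓝 0) →
      HasDerivAt (fun t => umbrella (ℓ t)) γ' 0 → umbrella (ℓ 0) = 0 →
      HasDerivAt X X' 0 → HasDerivAt Y Y' 0 →
      (∀ t, fderiv ℝ umbrella (ℓ t) (EuclideanSpace.single 0 1) = X t) →
      (∀ t, fderiv ℝ umbrella (ℓ t) (EuclideanSpace.single 1 1) = t • Y t) →
      β (G 0) (fderiv ℝ G 0 (X 0)) (fderiv ℝ G 0 (Y 0)) = 0 ∧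
      (γ' = 0 → β (G 0) (fderiv ℝ G 0 X') (fderiv ℝ G 0 (Y 0))
        + β (G 0) (fderiv ℝ G 0 (X 0)) (fderiv ℝ G 0 Y') = 0) := by
    intro ℓ γ' X Y X' Y' hℓ hγ hγ0 hX hY eX eY
    have hγG := hGd
    rw [← hγ0] at hγG
    have hγG2 := hGd2
    rw [← hγ0] at hγG2
    have d1 := hγG.comp_hasDerivAt (0 : ℝ) hγ
    have d2 := hγG2.comp_hasDerivAt (0 : ℝ) hγ
    have d3 := (hβ (G (umbrella (ℓ 0)))).hasFDerivAt.comp_hasDerivAt (0 : ℝ) d1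
    have d4 := (d3.clm_apply (d2.clm_apply hX)).clm_apply (d2.clm_apply hY)
    -- The factor `t` of `∂_v` cancels only for `t ≠ 0`; continuity then extends the vanishing to `t
    -- = 0`, so that the derivative there is zero as well.
    have hz : ∀ᶠ t in 𝓝[≠] (0 : ℝ), β (G (umbrella (ℓ t))) (fderiv ℝ G (umbrella (ℓ t)) (X t))
        (fderiv ℝ G (umbrella (ℓ t)) (Y t)) = 0 := by
      filter_upwards [(hℓ.eventually h').filter_mono nhdsWithin_le_nhds,
        self_mem_nhdsWithin] with t ht ht0
      have := ht (EuclideanSpace.single 0 1) (EuclideanSpace.single 1 1)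
      rw [eX, eY] at this
      simpa [show t ≠ 0 from ht0] using this
    have hz0 : β (G (umbrella (ℓ 0))) (fderiv ℝ G (umbrella (ℓ 0)) (X 0))
        (fderiv ℝ G (umbrella (ℓ 0)) (Y 0)) = 0 :=
      tendsto_nhds_unique (d4.continuousAt.tendsto.mono_left nhdsWithin_le_nhds)
        ((Filter.tendsto_congr' hz).2 tendsto_const_nhds)
    have hz' : (fun t => β (G (umbrella (ℓ t))) (fderiv ℝ G (umbrella (ℓ t)) (X t))
        (fderiv ℝ G (umbrella (ℓ t)) (Y t))) =ᶠ[𝓝 0] fun _ => 0 := by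
      rw [← nhdsNE_sup_pure (0 : ℝ)]
      exact Filter.eventually_sup.2 ⟨hz, hz0⟩
    -- When the curve has zero velocity, neither `β` at the moving point nor `dG` contributes to the
    -- derivative, so no second derivative of `G` survives.
    refine ⟨by simpa [hγ0] using hz0, fun hγ' => ?_⟩
    have := d4.unique ((hasDerivAt_const (0 : ℝ) (0 : ℝ)).congr_of_eventuallyEq hz')
    simpa [hγ', hγ0] using this
  have hs : ∀ w : Plane, Filter.Tendsto (fun t : ℝ => t • w) (𝓝 0) (𝓝 0) := by
    intro w
    have : Continuous (fun t : ℝ => t • w) := by fun_prop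
    simpa using this.tendsto 0
  have hγd : ∀ w : Plane, HasDerivAt (fun t : ℝ => umbrella (t • w)) (fderiv ℝ umbrella 0 w) 0 := by
    intro w
    have h1 : HasDerivAt (fun t : ℝ => t • w) w 0 := by
      simpa using (hasDerivAt_id (0 : ℝ)).smul_const w
    have h2 := (contDiff_umbrella.differentiable (by simp)
      ((0 : ℝ) • w)).hasFDerivAt.comp_hasDerivAt (0 : ℝ) h1
    rwa [zero_smul] at h2
  -- On the `u`-axis, `∂_u = e 0` and `∂_v = t • (3/2) e 4`.
  have A := along (fun t => t • EuclideanSpace.single 0 1) _ (fun _ => EuclideanSpace.single 0 1)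
    (fun _ => EuclideanSpace.single 4 (3 / 2)) 0 0 (hs _) (hγd _) (by simp [hu0])
    (hasDerivAt_const _ _) (hasDerivAt_const _ _)
    (fun t => by rw [fderiv_umbrella]; ext i; fin_cases i <;> simp)
    (fun t => by rw [fderiv_umbrella]; ext i; fin_cases i <;> simp [mul_comm])
  -- On the `v`-axis, `∂_u = e 0 + (3/2) t e 4 + t³ e 2` and `∂_v = t • (2 e 1 + 3 t e 3)`. The
  -- curve `(0, t², 0, t³, 0)` is a cusp, so its velocity at `0` vanishes. Both terms of the
  -- differentiated relation then have coefficient `3`.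
  have dX : HasDerivAt (fun t : ℝ => EuclideanSpace.single 0 1 + t • EuclideanSpace.single 4 (3 / 2)
      + t ^ 3 • EuclideanSpace.single 2 1 : ℝ → R5) (EuclideanSpace.single 4 (3 / 2)) 0 := by
    simpa using (((hasDerivAt_id (0 : ℝ)).smul_const
      (EuclideanSpace.single 4 (3 / 2) : R5)).const_add (EuclideanSpace.single 0 1)).fun_add
      ((hasDerivAt_pow 3 (0 : ℝ)).smul_const (EuclideanSpace.single 2 1 : R5))
  have dY : HasDerivAt (fun t : ℝ => EuclideanSpace.single 1 2 + t • EuclideanSpace.single 3 3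
      : ℝ → R5) (EuclideanSpace.single 3 3) 0 := by
    simpa using ((hasDerivAt_id (0 : ℝ)).smul_const
      (EuclideanSpace.single 3 3 : R5)).const_add (EuclideanSpace.single 1 2)
  have B := along (fun t => t • EuclideanSpace.single 1 1) _ _ _ _ _ (hs _) (hγd _) (by simp [hu0])
    dX dY
    (fun t => by rw [fderiv_umbrella]; ext i; fin_cases i <;> simp [mul_comm])
    (fun t => by rw [fderiv_umbrella]; ext i; fin_cases i <;> simp <;> ring)
  have hB := B.2 (by rw [fderiv_umbrella]; ext i; fin_cases i <;> simp)
  have es : ∀ (i : Fin 5) (r : ℝ), fderiv ℝ G 0 (EuclideanSpace.single i r) = r • E i := by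
    intro i r
    rw [hE, ← map_smul]
    congr 1
    ext j; by_cases hj : j = i <;> simp [hj]
  have A1 := A.1
  have B1 := B.1
  simp [es] at A1 B1 hB
  refine ⟨B1, A1, by linarith⟩

end

/-! ### Reduction from the manifold to the normal form -/

theorem dR5_apply (i : Fin 5) (P : R5) (v : R5) : dR5 i P v = v i := by
  have : HasFDerivAt (fun Q : R5 => Q i) (EuclideanSpace.proj (𝕜 := ℝ) i) P :=
    (EuclideanSpace.proj (𝕜 := ℝ) i).hasFDerivAt
  simp only [dR5, mvfderiv, mfderiv_eq_fderiv, this.fderiv]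
  rfl

theorem thetaR5_apply (P : R5) (v : R5) : thetaR5 P v = v 2 - P 3 * v 0 - P 4 * v 1 := by
  have h0 := dR5_apply 0 P v
  have h1 := dR5_apply 1 P v
  have h2 := dR5_apply 2 P v
  rw [← h0, ← h1, ← h2]
  rfl

section

variable {V : Type*} [NormedAddCommGroup V] [NormedSpace ℝ V]
  {E : Type*} [NormedAddCommGroup E] [NormedSpace ℝ E]
  {H : Type*} [TopologicalSpace H] {I : ModelWithCorners ℝ E H}
  {M : Type*} [TopologicalSpace M] [ChartedSpace H M]

/-- Consider a form `θ` and a 2-form `Ω` on `M`, restrictions of forms `θV`, `ΩV` on a vector space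
`V` along a map `ι`. If, at each point, the restrictions to `ker θ` of `Ω` and `dθ` are
`c dx ∧ dy - dp ∧ dq` and `dp ∧ dx + dq ∧ dy` in linear coordinates `(x, y, p, q)` of `ker θ`, then
no open umbrella is a generalized geometric solution. -/
theorem IsOpenUmbrella.not_isGeneralizedGeometricSolution {c : ℝ} (hc : c ≠ 0)
    {ι : M → V} (hι : ContMDiff I 𝓘(ℝ, V) ∞ ι)
    {θ : (m : M) → TangentSpace I m →L[ℝ] ℝ}
    {Ω : (m : M) → TangentSpace I m → TangentSpace I m → ℝ}
    {θV : V → V →L[ℝ] ℝ} (hθV : ContDiff ℝ 2 θV)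
    {ΩV : V → V →L[ℝ] V →L[ℝ] ℝ} (hΩV : Differentiable ℝ ΩV)
    (hθ : ∀ m v, θ m v = θV (ι m) (mfderiv I 𝓘(ℝ, V) ι m v))
    (hΩ : ∀ m v w, Ω m v w = ΩV (ι m) (mfderiv I 𝓘(ℝ, V) ι m v) (mfderiv I 𝓘(ℝ, V) ι m w))
    (hL : ∀ m, ∃ L : TangentSpace I m →ₗ[ℝ] (Fin 4 → ℝ),
      (∀ v, θ m v = 0 → L v = 0 → v = 0) ∧
      (∀ v w, θ m v = 0 → θ m w = 0 →
        Ω m v w = c * (L v 0 * L w 1 - L w 0 * L v 1) - (L v 2 * L w 3 - L w 2 * L v 3)) ∧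
      (∀ v w, θ m v = 0 → θ m w = 0 →
        fderiv ℝ θV (ι m) (mfderiv I 𝓘(ℝ, V) ι m v) (mfderiv I 𝓘(ℝ, V) ι m w)
          - fderiv ℝ θV (ι m) (mfderiv I 𝓘(ℝ, V) ι m w) (mfderiv I 𝓘(ℝ, V) ι m v)
          = (L v 2 * L w 0 - L w 2 * L v 0) + (L v 3 * L w 1 - L w 3 * L v 1)))
    {f : Plane → M} (hf : IsOpenUmbrella I θ f) :
    ¬ IsGeneralizedGeometricSolution I θ Ω f := by
  rintro ⟨⟨hfs, hfθ⟩, hfΩ⟩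
  obtain ⟨-, σ, Φ, hσ, hσ0, ⟨hΦ, hΦθ⟩, hΦ0, heq⟩ := hf
  obtain ⟨τ, hτ, hτ0, hστ⟩ : ∃ τ : Plane → Plane, ContMDiffAt 𝓘(ℝ, Plane) 𝓘(ℝ, Plane) ∞ τ 0 ∧
      τ 0 = 0 ∧ ∀ᶠ b in 𝓝 (0 : Plane), σ (τ b) = b := by
    refine ⟨hσ.localInverse, ?_, ?_, ?_⟩
    · simpa [hσ0] using hσ.localInverse_contMDiffAt
    · simpa [hσ0] using hσ.localInverse_left_inv hσ.localInverse_mem_target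
    · simpa [hσ0, Filter.EventuallyEq] using hσ.localInverse_eventuallyEq_right
  obtain ⟨Ψ, hΨ, hΨ0, hΦΨ, hΨΦ⟩ : ∃ Ψ : R5 → M, ContMDiffAt 𝓘(ℝ, R5) I ∞ Ψ 0 ∧
      Ψ 0 = f 0 ∧ (∀ᶠ P in 𝓝 (0 : R5), Φ (Ψ P) = P) ∧ ∀ᶠ m in 𝓝 (f 0), Ψ (Φ m) = m := by
    refine ⟨hΦ.localInverse, ?_, ?_, ?_, ?_⟩
    · simpa [hΦ0] using hΦ.localInverse_contMDiffAt
    · simpa [hΦ0] using hΦ.localInverse_left_inv hΦ.localInverse_mem_target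
    · simpa [hΦ0, Filter.EventuallyEq] using hΦ.localInverse_eventuallyEq_right
    · simpa [Filter.EventuallyEq] using hΦ.localInverse_eventuallyEq_left
  have hτt : Filter.Tendsto τ (𝓝 0) (𝓝 0) := by simpa [hτ0] using hτ.continuousAt.tendsto
  have hft : Filter.Tendsto f (𝓝 0) (𝓝 (f 0)) := hfs.self_of_nhds.continuousAt
  have hτd : ∀ᶠ b in 𝓝 (0 : Plane), DifferentiableAt ℝ τ b := by
    have h1 : ContDiffAt ℝ 1 τ 0 := hτ.contDiffAt.of_le (WithTop.coe_le_coe.2 le_top)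
    filter_upwards [h1.eventually (by simp)] with b hb using hb.differentiableAt (by simp)
  have hG : ContDiffAt ℝ ∞ (ι ∘ Ψ) 0 := ((hι _).comp (0 : R5) hΨ).contDiffAt
  have hF : ContDiffAt ℝ 2 ((ι ∘ Ψ) ∘ umbrella) 0 := by
    have hu0 : umbrella 0 = 0 := by ext i; fin_cases i <;> simp [umbrella]
    have h2 : ContDiffAt ℝ ∞ (ι ∘ Ψ) (umbrella 0) := by rwa [hu0]
    exact (h2.comp 0 contDiff_umbrella.contDiffAt).of_le (WithTop.coe_le_coe.2 le_top)
  -- The inverse germs `τ`, `Ψ` turn `Φ ∘ f = umbrella ∘ σ` into `Ψ ∘ umbrella = f ∘ τ`.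
  have hFf : ((ι ∘ Ψ) ∘ umbrella) =ᶠ[𝓝 0] ((ι ∘ f) ∘ τ) := by
    filter_upwards [hστ, hτt.eventually heq, (hft.comp hτt).eventually hΨΦ] with b h1 h2 h3
    simp only [Function.comp_apply] at h3 ⊢
    rw [← h3, h2, h1]
  have hFd : ∀ᶠ b in 𝓝 (0 : Plane), ((ι ∘ Ψ) ∘ umbrella) b = ι (f (τ b)) ∧
      ∀ v, fderiv ℝ ((ι ∘ Ψ) ∘ umbrella) b v
        = mfderiv I 𝓘(ℝ, V) ι (f (τ b)) (mfderiv 𝓘(ℝ, Plane) I f (τ b) (fderiv ℝ τ b v)) := by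
    filter_upwards [hFf.eventuallyEq_nhds, hτd, hτt.eventually hfs] with b h1 h2 h3
    refine ⟨h1.self_of_nhds, fun v => ?_⟩
    rw [h1.fderiv_eq, ← mfderiv_eq_fderiv, ← mfderiv_eq_fderiv]
    have k1 : MDifferentiableAt 𝓘(ℝ, Plane) I f (τ b) := h3.mdifferentiableAt (by simp)
    have k2 : MDifferentiableAt I 𝓘(ℝ, V) ι (f (τ b)) := (hι _).mdifferentiableAt (by simp)
    rw [mfderiv_comp b (k2.comp _ k1) h2.mdifferentiableAt, mfderiv_comp _ k2 k1]
    rfl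
  have hFθ : ∀ᶠ b in 𝓝 (0 : Plane), ∀ v, θV (((ι ∘ Ψ) ∘ umbrella) b)
      (fderiv ℝ ((ι ∘ Ψ) ∘ umbrella) b v) = 0 := by
    filter_upwards [hFd, hτt.eventually hfθ] with b h1 h2 v
    rw [h1.1, h1.2, ← hθ]
    exact h2 _
  have hFΩ : ∀ᶠ b in 𝓝 (0 : Plane), ∀ v w, ΩV ((ι ∘ Ψ) (umbrella b))
      (fderiv ℝ ((ι ∘ Ψ) ∘ umbrella) b v) (fderiv ℝ ((ι ∘ Ψ) ∘ umbrella) b w) = 0 := by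
    filter_upwards [hFd, hτt.eventually hfΩ] with b h1 h2 v w
    have h3 : (ι ∘ Ψ) (umbrella b) = ι (f (τ b)) := h1.1
    rw [h3, h1.2, h1.2, ← hΩ]
    exact h2 _ _
  have hθVd : Differentiable ℝ (fderiv ℝ θV) :=
    (hθV.fderiv_right (m := 1) (by norm_num)).differentiable (by simp)
  have hβd : Differentiable ℝ (fun P => fderiv ℝ θV P - (fderiv ℝ θV P).flip) := by
    have hflip : Differentiable ℝ (fun P => (fderiv ℝ θV P).flip) :=
      (ContinuousLinearMap.flipₗᵢ ℝ V V ℝ).differentiable.comp hθVd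
    fun_prop
  have hFdθ := eventually_pullback_extDeriv_eq_zero hF (hθV.differentiable (by simp)) hFθ
  obtain ⟨a1, a2, a3⟩ := pairing_eq_zero_of_umbrella hG hΩV hFΩ _ fun _ => rfl
  obtain ⟨b1, b2, b3⟩ := pairing_eq_zero_of_umbrella hG hβd hFdθ _ fun _ => rfl
  have kΨ : MDifferentiableAt 𝓘(ℝ, R5) I Ψ 0 := hΨ.mdifferentiableAt (by simp)
  have hGd : ∀ v : R5, fderiv ℝ (ι ∘ Ψ) 0 v
      = mfderiv I 𝓘(ℝ, V) ι (Ψ 0) (mfderiv 𝓘(ℝ, R5) I Ψ 0 v) := by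
    intro v
    rw [← mfderiv_eq_fderiv, mfderiv_comp (0 : R5) ((hι _).mdifferentiableAt (by simp)) kΨ]
    rfl
  have hid : ∀ v : R5, mfderiv I 𝓘(ℝ, R5) Φ (Ψ 0) (mfderiv 𝓘(ℝ, R5) I Ψ 0 v) = v := by
    intro v
    have kΦ : MDifferentiableAt I 𝓘(ℝ, R5) Φ (Ψ 0) := by
      rw [hΨ0]; exact hΦ.mdifferentiableAt (by simp)
    have h1 : Φ ∘ Ψ =ᶠ[𝓝 (0 : R5)] id := hΦΨ
    have h2 := mfderiv_comp (0 : R5) kΦ kΨ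
    rw [h1.mfderiv_eq, mfderiv_id] at h2
    exact (congrArg (fun L => L v) h2).symm
  -- At the origin the standard contact form is `dz`, so the contact hyperplane is `v 2 = 0`.
  have hθ0 : ∀ v : R5, v 2 = 0 → θ (Ψ 0) (mfderiv 𝓘(ℝ, R5) I Ψ 0 v) = 0 := by
    intro v hv
    have h1 := hΦθ.self_of_nhds
    rw [← hΨ0] at h1
    rw [← h1, hid]
    have hz : Φ (Ψ 0) = 0 := by rw [hΨ0, hΦ0]
    have := thetaR5_apply (Φ (Ψ 0)) v
    rw [hz] at this ⊢
    simpa [hv] using this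
  obtain ⟨L, hLinj, hLΩ, hLθ⟩ := hL (Ψ 0)
  let T : R5 →ₗ[ℝ] (Fin 4 → ℝ) := L ∘ₗ (mfderiv 𝓘(ℝ, R5) I Ψ 0).toLinearMap
  have hTΩ : ∀ v w : R5, v 2 = 0 → w 2 = 0 →
      ΩV ((ι ∘ Ψ) 0) (fderiv ℝ (ι ∘ Ψ) 0 v) (fderiv ℝ (ι ∘ Ψ) 0 w)
        = c * (T v 0 * T w 1 - T w 0 * T v 1) - (T v 2 * T w 3 - T w 2 * T v 3) := by
    intro v w hv hw
    rw [hGd, hGd]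
    exact (hΩ _ _ _).symm.trans (hLΩ _ _ (hθ0 v hv) (hθ0 w hw))
  have hTθ : ∀ v w : R5, v 2 = 0 → w 2 = 0 →
      (fderiv ℝ θV ((ι ∘ Ψ) 0) - (fderiv ℝ θV ((ι ∘ Ψ) 0)).flip) (fderiv ℝ (ι ∘ Ψ) 0 v)
        (fderiv ℝ (ι ∘ Ψ) 0 w)
        = (T v 2 * T w 0 - T w 2 * T v 0) + (T v 3 * T w 1 - T w 3 * T v 1) := by
    intro v w hv hw
    rw [hGd, hGd]
    exact hLθ _ _ (hθ0 v hv) (hθ0 w hw)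
  have hTinj : ∀ v : R5, v 2 = 0 → T v = 0 → v = 0 := by
    intro v hv hTv
    have := hLinj _ (hθ0 v hv) hTv
    rw [← hid v, this]
    exact map_zero _
  let s (i : Fin 5) : R5 := EuclideanSpace.single i 1
  refine not_linearIndependent_of_effective hc (T (s 0)) (T (s 1)) (T (s 3)) (T (s 4))
    (fun v w => c * (v 0 * w 1 - w 0 * v 1) - (v 2 * w 3 - w 2 * v 3))
    (fun v w => (v 2 * w 0 - w 2 * v 0) + (v 3 * w 1 - w 3 * v 1))
    (fun _ _ => rfl) (fun _ _ => rfl) ?_ ?_ ?_ ?_ ?_ ?_ ?_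
  · exact (hTΩ (s 0) (s 1) (by simp [s]) (by simp [s])).symm.trans a1
  · exact (hTΩ (s 0) (s 4) (by simp [s]) (by simp [s])).symm.trans a2
  · exact (congrArg₂ (· + ·) (hTΩ (s 4) (s 1) (by simp [s]) (by simp [s]))
      (hTΩ (s 0) (s 3) (by simp [s]) (by simp [s]))).symm.trans a3
  · exact (hTθ (s 0) (s 1) (by simp [s]) (by simp [s])).symm.trans b1
  · exact (hTθ (s 0) (s 4) (by simp [s]) (by simp [s])).symm.trans b2
  · exact (congrArg₂ (· + ·) (hTθ (s 4) (s 1) (by simp [s]) (by simp [s]))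
      (hTθ (s 0) (s 3) (by simp [s]) (by simp [s]))).symm.trans b3
  · rw [Fintype.linearIndependent_iff]
    intro g hg
    have hv : T (g 0 • s 0 + g 1 • s 1 + g 2 • s 3 + g 3 • s 4) = 0 := by
      rw [Fin.sum_univ_four] at hg
      simp only [map_add, map_smul]
      exact hg
    have h0 := hTinj _ (by simp [s]) hv
    have e (i : Fin 5) := congrArg (fun P : R5 => P i) h0
    have e0 := e 0
    have e1 := e 1
    have e3 := e 3
    have e4 := e 4
    simp [s] at e0 e1 e3 e4
    intro i
    fin_cases i <;> assumption

end

/-! ### The system Hess = c -/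

/-- The wedge product of two covectors, as a continuous bilinear form. -/
noncomputable def wedgeL {V : Type*} [NormedAddCommGroup V] [NormedSpace ℝ V] (α β : V →L[ℝ] ℝ) :
    V →L[ℝ] V →L[ℝ] ℝ :=
  α.smulRight β - β.smulRight α

theorem wedgeL_apply {V : Type*} [NormedAddCommGroup V] [NormedSpace ℝ V] (α β : V →L[ℝ] ℝ)
    (v w : V) : wedgeL α β v w = α v * β w - α w * β v := by
  simp [wedgeL, mul_comm (β v)]

theorem omegaHess_apply (c : ℝ) (P v w : R5) :
    omegaHess c P v w = c * (v 0 * w 1 - w 0 * v 1) - (v 3 * w 4 - w 3 * v 4) := by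
  have h (i : Fin 5) := dR5_apply i P
  rw [← h, ← h, ← h, ← h, ← h, ← h, ← h, ← h]
  rfl

theorem not_isGeneralizedGeometricSolution_hess {c : ℝ} (hc : c ≠ 0) {f : Plane → R5}
    (hf : IsOpenUmbrella 𝓘(ℝ, R5) thetaR5 f) :
    ¬ IsGeneralizedGeometricSolution 𝓘(ℝ, R5) thetaR5 (omegaHess c) f := by
  let π (i : Fin 5) : R5 →L[ℝ] ℝ := EuclideanSpace.proj i
  have hθ' (P : R5) : HasFDerivAt (fun P : R5 => π 2 - π 3 P • π 0 - π 4 P • π 1)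
      (- (π 3).smulRight (π 0) - (π 4).smulRight (π 1)) P := by
    have h3 := (π 3).hasFDerivAt (x := P)
    have h4 := (π 4).hasFDerivAt (x := P)
    simpa using ((h3.smul_const (π 0)).const_sub (π 2)).fun_sub (h4.smul_const (π 1))
  refine hf.not_isGeneralizedGeometricSolution hc (ι := id) contMDiff_id
    (θV := fun P => π 2 - π 3 P • π 0 - π 4 P • π 1)
    (ΩV := fun _ => c • wedgeL (π 0) (π 1) - wedgeL (π 3) (π 4))
    (by fun_prop) (by fun_prop) ?_ ?_ ?_
  · intro P v
    rw [mfderiv_id]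
    exact thetaR5_apply P v
  · intro P (v : R5) (w : R5)
    rw [mfderiv_id]
    refine (omegaHess_apply c P v w).trans ?_
    change _ = c * wedgeL (π 0) (π 1) v w - wedgeL (π 3) (π 4) v w
    rw [wedgeL_apply, wedgeL_apply]
    rfl
  · intro P
    -- Here `dθ = -(dp ∧ dx + dq ∧ dy)`; replacing `(p, q)` by `(-p, -q)` corrects this sign and
    -- leaves `dp ∧ dq` unchanged.
    refine ⟨(LinearMap.pi ![(π 0).toLinearMap, (π 1).toLinearMap, -(π 3).toLinearMap,
      -(π 4).toLinearMap] : R5 →ₗ[ℝ] (Fin 4 → ℝ)), ?_, ?_, ?_⟩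
    · intro (v : R5) h1 h2
      have h1' := (thetaR5_apply P v).symm.trans h1
      have e (i : Fin 4) := congrFun h2 i
      have e0 : v 0 = 0 := e 0
      have e1 : v 1 = 0 := e 1
      have e3 : -v 3 = 0 := e 2
      have e4 : -v 4 = 0 := e 3
      rw [e0, e1] at h1'
      change v = 0
      ext i
      fin_cases i <;> simp <;> linarith
    · intro (v : R5) (w : R5) _ _
      refine (omegaHess_apply c P v w).trans ?_
      change c * (v 0 * w 1 - w 0 * v 1) - (v 3 * w 4 - w 3 * v 4) =
        c * (v 0 * w 1 - w 0 * v 1) - (-v 3 * -w 4 - -w 3 * -v 4)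
      ring
    · intro (v : R5) (w : R5) _ _
      rw [mfderiv_id, (hθ' _).fderiv]
      change (-(v 3 * w 0) - v 4 * w 1) - (-(w 3 * v 0) - w 4 * v 1)
        = (-v 3 * w 0 - -w 3 * v 0) + (-v 4 * w 1 - -w 4 * v 1)
      ring

/-! ### The system K = c on the unit tangent bundle -/

/-- A unit vector `y` of `ℝ³` is completed to an oriented orthonormal basis `(y, a, b)`; here are
the coordinate expressions of the scalar and triple products on the plane orthogonal to `y`. -/
theorem exists_orthonormal_frame (y : Fin 3 → ℝ) (hy : y 0 ^ 2 + y 1 ^ 2 + y 2 ^ 2 = 1) :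
    ∃ a b : Fin 3 → ℝ, (∀ s t : Fin 3 → ℝ, y ⬝ᵥ s = 0 →
      s ⬝ᵥ t = (a ⬝ᵥ s) * (a ⬝ᵥ t) + (b ⬝ᵥ s) * (b ⬝ᵥ t)) ∧
      ∀ s t : Fin 3 → ℝ,
        y 0 * (s 1 * t 2 - t 1 * s 2) + y 1 * (s 2 * t 0 - t 2 * s 0)
          + y 2 * (s 0 * t 1 - t 0 * s 1) = (a ⬝ᵥ s) * (b ⬝ᵥ t) - (a ⬝ᵥ t) * (b ⬝ᵥ s) := by
  obtain ⟨a, ha, hya⟩ : ∃ a : Fin 3 → ℝ, a 0 ^ 2 + a 1 ^ 2 + a 2 ^ 2 = 1 ∧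
      y 0 * a 0 + y 1 * a 1 + y 2 * a 2 = 0 := by
    by_cases h : y 0 ^ 2 + y 1 ^ 2 = 0
    · have h0 : y 0 = 0 := by nlinarith [sq_nonneg (y 0), sq_nonneg (y 1)]
      exact ⟨![1, 0, 0], by simp, by simp [h0]⟩
    · have hr : √(y 0 ^ 2 + y 1 ^ 2) ^ 2 = y 0 ^ 2 + y 1 ^ 2 := Real.sq_sqrt (by positivity)
      have hr0 : √(y 0 ^ 2 + y 1 ^ 2) ≠ 0 := by
        intro h0; rw [h0] at hr; exact h (by linarith)
      -- A quarter turn of the horizontal part of `y`, normalised; it is undefined only when `y` is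
      -- vertical, the case treated above.
      refine ⟨![-y 1 / √(y 0 ^ 2 + y 1 ^ 2), y 0 / √(y 0 ^ 2 + y 1 ^ 2), 0], ?_, ?_⟩
      · simp only [Matrix.cons_val, div_pow, hr]
        field_simp
        ring
      · simp only [Matrix.cons_val]
        ring
  -- `b = y × a`.
  let b : Fin 3 → ℝ :=
    ![y 1 * a 2 - y 2 * a 1, y 2 * a 0 - y 0 * a 2, y 0 * a 1 - y 1 * a 0]
  have hM : Matrix.of ![y, a, b] * (Matrix.of ![y, a, b]).transpose = 1 := by
    ext i j
    fin_cases i <;> fin_cases j <;>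
      simp [Matrix.mul_apply, Fin.sum_univ_three, b]
    · linear_combination hy
    · linear_combination hya
    · ring
    · linear_combination hya
    · linear_combination ha
    · ring
    · ring
    · ring
    · linear_combination hy * (a 0 ^ 2 + a 1 ^ 2 + a 2 ^ 2) + ha
        - (y 0 * a 0 + y 1 * a 1 + y 2 * a 2) * hya
  -- Orthonormal rows give orthonormal columns, that is, the resolution of the identity by `y, a,
  -- b`.
  have hM' := mul_eq_one_comm.1 hM
  have e (i j : Fin 3) : y i * y j + a i * a j + b i * b j = if i = j then 1 else 0 := by
    have := congrFun (congrFun hM' i) j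
    simpa [Matrix.mul_apply, Fin.sum_univ_three, Matrix.one_apply] using this
  refine ⟨a, b, fun s t hs => ?_, fun s t => ?_⟩
  · have h00 := e 0 0
    have h01 := e 0 1
    have h02 := e 0 2
    have h11 := e 1 1
    have h12 := e 1 2
    have h22 := e 2 2
    simp only [if_true, show ((0 : Fin 3) = 1) = False by decide,
      show ((0 : Fin 3) = 2) = False by decide, show ((1 : Fin 3) = 2) = False by decide,
      if_false] at h00 h01 h02 h11 h12 h22
    simp only [dotProduct, Fin.sum_univ_three] at hs ⊢
    linear_combination - s 0 * t 0 * h00 - (s 0 * t 1 + s 1 * t 0) * h01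
      - (s 0 * t 2 + s 2 * t 0) * h02 - s 1 * t 1 * h11 - (s 1 * t 2 + s 2 * t 1) * h12
      - s 2 * t 2 * h22 + (y 0 * t 0 + y 1 * t 1 + y 2 * t 2) * hs
  -- With `y = a × b`, from `a × (y × a) = |a|² y - (a · y) a`, the claim is the Binet–Cauchy
  -- identity for `(a × b) · (s × t)`.
  · have c0 : a 1 * b 2 - a 2 * b 1 = y 0 := by
      simp [b]; linear_combination y 0 * ha - a 0 * hya
    have c1 : a 2 * b 0 - a 0 * b 2 = y 1 := by
      simp [b]; linear_combination y 1 * ha - a 1 * hya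
    have c2 : a 0 * b 1 - a 1 * b 0 = y 2 := by
      simp [b]; linear_combination y 2 * ha - a 2 * hya
    rw [← c0, ← c1, ← c2]
    simp only [dotProduct, Fin.sum_univ_three]
    ring

/-- The inclusion of `ℝ³ × S²` into `ℝ³ × ℝ³`. -/
def inclUT (m : UnitTangent) : EuclideanSpace ℝ (Fin 3) × EuclideanSpace ℝ (Fin 3) :=
  (m.1, m.2.1)

theorem contMDiff_inclUT :
    ContMDiff modelUT 𝓘(ℝ, EuclideanSpace ℝ (Fin 3) × EuclideanSpace ℝ (Fin 3)) ∞ inclUT :=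
  have : Fact (Module.finrank ℝ (EuclideanSpace ℝ (Fin 3)) = 2 + 1) := ⟨finrank_euclideanSpace_fin⟩
  contMDiff_fst.prodMk_space (contMDiff_coe_sphere.comp contMDiff_snd)

/-- The differential of the inclusion of `ℝ³ × S²` into `ℝ³ × ℝ³`. -/
noncomputable def dInclUT (m : UnitTangent) : TangentSpace modelUT m →L[ℝ]
    EuclideanSpace ℝ (Fin 3) × EuclideanSpace ℝ (Fin 3) :=
  mfderiv modelUT 𝓘(ℝ, EuclideanSpace ℝ (Fin 3) × EuclideanSpace ℝ (Fin 3)) inclUT m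

theorem mfderiv_comp_inclUT {W : Type*} [NormedAddCommGroup W] [NormedSpace ℝ W]
    {ℓ : EuclideanSpace ℝ (Fin 3) × EuclideanSpace ℝ (Fin 3) → W} (m : UnitTangent)
    {ℓ' : EuclideanSpace ℝ (Fin 3) × EuclideanSpace ℝ (Fin 3) →L[ℝ] W}
    (hℓ : HasFDerivAt ℓ ℓ' (inclUT m)) (v : TangentSpace modelUT m) :
    mfderiv modelUT 𝓘(ℝ, W) (fun n => ℓ (inclUT n)) m v = ℓ' (dInclUT m v) := by
  have h := mfderiv_comp m hℓ.differentiableAt.mdifferentiableAt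
    ((contMDiff_inclUT m).mdifferentiableAt (by simp))
  rw [mfderiv_eq_fderiv, hℓ.fderiv] at h
  exact congrArg (fun L => L v) h

theorem dX_apply (i : Fin 3) (m : UnitTangent) (v : TangentSpace modelUT m) :
    dX i m v = (dInclUT m v).1 i :=
  mfderiv_comp_inclUT m ((EuclideanSpace.proj (𝕜 := ℝ) i).comp (ContinuousLinearMap.fst ℝ
    (EuclideanSpace ℝ (Fin 3)) (EuclideanSpace ℝ (Fin 3)))).hasFDerivAt v

theorem dY_apply (i : Fin 3) (m : UnitTangent) (v : TangentSpace modelUT m) :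
    dY i m v = (dInclUT m v).2 i :=
  mfderiv_comp_inclUT m ((EuclideanSpace.proj (𝕜 := ℝ) i).comp (ContinuousLinearMap.snd ℝ
    (EuclideanSpace ℝ (Fin 3)) (EuclideanSpace ℝ (Fin 3)))).hasFDerivAt v

/-- The coordinates used on contact hyperplanes see a tangent vector only through its image in `ℝ³ ×
ℝ³`; injectivity makes them separate vectors. -/
theorem dInclUT_injective (m : UnitTangent) : Function.Injective (dInclUT m) := by
  have : Fact (Module.finrank ℝ (EuclideanSpace ℝ (Fin 3)) = 2 + 1) := ⟨finrank_euclideanSpace_fin⟩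
  refine (injective_iff_map_eq_zero _).2 fun v hv => ?_
  have h1 := mfderiv_comp_inclUT m (ContinuousLinearMap.hasFDerivAt
    (ContinuousLinearMap.fst ℝ _ _)) v
  have h2 := mfderiv_comp_inclUT m (ContinuousLinearMap.hasFDerivAt
    (ContinuousLinearMap.snd ℝ _ _)) v
  rw [hv, map_zero] at h1 h2
  have k1 : v.1 = 0 := by
    have : mfderiv modelUT (𝓡 3) (@Prod.fst (EuclideanSpace ℝ (Fin 3))
      (Metric.sphere (0 : EuclideanSpace ℝ (Fin 3)) 1)) m v = 0 := h1
    rw [mfderiv_fst] at this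
    exact this
  have k2 : v.2 = 0 := by
    have h3 := mfderiv_comp m
      ((contMDiff_coe_sphere (n := 2) (m := ∞) m.2).mdifferentiableAt (by simp))
      (mdifferentiableAt_snd (I := 𝓡 3) (I' := 𝓡 2) (x := m))
    have h4 := (congrArg (fun L => L v) h3).symm.trans h2
    rw [mfderiv_snd] at h4
    exact (injective_iff_map_eq_zero _).1 (injective_mvfderiv_subtypeVal_sphere m.2) _ h4
  exact Prod.ext k1 k2

theorem sum_sq_sphere (m : UnitTangent) : m.2.1 0 ^ 2 + m.2.1 1 ^ 2 + m.2.1 2 ^ 2 = 1 := by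
  have h := m.2.2
  rw [mem_sphere_zero_iff_norm] at h
  have := EuclideanSpace.real_norm_sq_eq m.2.1
  rw [h, Fin.sum_univ_three] at this
  linarith

/-- Differentiate `|y|² = 1`. -/
theorem dotProduct_dInclUT_snd (m : UnitTangent) (v : TangentSpace modelUT m) :
    m.2.1 0 * (dInclUT m v).2 0 + m.2.1 1 * (dInclUT m v).2 1 + m.2.1 2 * (dInclUT m v).2 2
      = 0 := by
  let y (i : Fin 3) : EuclideanSpace ℝ (Fin 3) × EuclideanSpace ℝ (Fin 3) →L[ℝ] ℝ :=
    (EuclideanSpace.proj i).comp (ContinuousLinearMap.snd ℝ _ _)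
  have hy (i : Fin 3) := (y i).hasFDerivAt (x := inclUT m)
  have h := mfderiv_comp_inclUT m ((((hy 0).pow 2).fun_add ((hy 1).pow 2)).fun_add ((hy 2).pow 2)) v
  have hc : (fun n : UnitTangent => y 0 (inclUT n) ^ 2 + y 1 (inclUT n) ^ 2 + y 2 (inclUT n) ^ 2)
      = fun _ => 1 := funext sum_sq_sphere
  rw [hc, mfderiv_const] at h
  have h' : (0 : ℝ) = 2 * m.2.1 0 * (dInclUT m v).2 0 + 2 * m.2.1 1 * (dInclUT m v).2 1
      + 2 * m.2.1 2 * (dInclUT m v).2 2 := by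
    refine Eq.trans h ?_
    simp [y, inclUT]
  linarith

theorem thetaUT_apply (m : UnitTangent) (v : TangentSpace modelUT m) :
    thetaUT m v = m.2.1 0 * (dInclUT m v).1 0 + m.2.1 1 * (dInclUT m v).1 1
      + m.2.1 2 * (dInclUT m v).1 2 := by
  rw [← dX_apply, ← dX_apply, ← dX_apply]
  rfl

theorem omegaK_apply (c : ℝ) (m : UnitTangent) (v w : TangentSpace modelUT m) :
    omegaK c m v w =
      c * (m.2.1 0 * ((dInclUT m v).1 1 * (dInclUT m w).1 2 - (dInclUT m w).1 1 * (dInclUT m v).1 2)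
        + m.2.1 1 * ((dInclUT m v).1 2 * (dInclUT m w).1 0 - (dInclUT m w).1 2 * (dInclUT m v).1 0)
        + m.2.1 2 * ((dInclUT m v).1 0 * (dInclUT m w).1 1 - (dInclUT m w).1 0 * (dInclUT m v).1 1))
      - (m.2.1 0 * ((dInclUT m v).2 1 * (dInclUT m w).2 2 - (dInclUT m w).2 1 * (dInclUT m v).2 2)
        + m.2.1 1 * ((dInclUT m v).2 2 * (dInclUT m w).2 0 - (dInclUT m w).2 2 * (dInclUT m v).2 0)
        + m.2.1 2 * ((dInclUT m v).2 0 * (dInclUT m w).2 1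
          - (dInclUT m w).2 0 * (dInclUT m v).2 1)) := by
  simp only [omegaK, wedge, dX_apply, dY_apply]

theorem not_isGeneralizedGeometricSolution_gauss {c : ℝ} (hc : c ≠ 0) {f : Plane → UnitTangent}
    (hf : IsOpenUmbrella modelUT thetaUT f) :
    ¬ IsGeneralizedGeometricSolution modelUT thetaUT (omegaK c) f := by
  let x (i : Fin 3) : EuclideanSpace ℝ (Fin 3) × EuclideanSpace ℝ (Fin 3) →L[ℝ] ℝ :=
    (EuclideanSpace.proj i).comp (ContinuousLinearMap.fst ℝ _ _)
  let y (i : Fin 3) : EuclideanSpace ℝ (Fin 3) × EuclideanSpace ℝ (Fin 3) →L[ℝ] ℝ :=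
    (EuclideanSpace.proj i).comp (ContinuousLinearMap.snd ℝ _ _)
  have hθ' (P : EuclideanSpace ℝ (Fin 3) × EuclideanSpace ℝ (Fin 3)) :
      HasFDerivAt (fun P => y 0 P • x 0 + y 1 P • x 1 + y 2 P • x 2)
        ((y 0).smulRight (x 0) + (y 1).smulRight (x 1) + (y 2).smulRight (x 2)) P := by
    have h (i : Fin 3) := ((y i).hasFDerivAt (x := P)).smul_const (x i)
    exact ((h 0).fun_add (h 1)).fun_add (h 2)
  refine hf.not_isGeneralizedGeometricSolution hc contMDiff_inclUT
    (θV := fun P => y 0 P • x 0 + y 1 P • x 1 + y 2 P • x 2)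
    (ΩV := fun P => c • (y 0 P • wedgeL (x 1) (x 2) + y 1 P • wedgeL (x 2) (x 0)
        + y 2 P • wedgeL (x 0) (x 1))
      - (y 0 P • wedgeL (y 1) (y 2) + y 1 P • wedgeL (y 2) (y 0) + y 2 P • wedgeL (y 0) (y 1)))
    (by fun_prop) (by fun_prop) ?_ ?_ ?_
  · intro m v
    exact thetaUT_apply m v
  · intro m v w
    refine (omegaK_apply c m v w).trans ?_
    change _ = c * (m.2.1 0 * wedgeL (x 1) (x 2) (dInclUT m v) (dInclUT m w)
        + m.2.1 1 * wedgeL (x 2) (x 0) (dInclUT m v) (dInclUT m w)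
        + m.2.1 2 * wedgeL (x 0) (x 1) (dInclUT m v) (dInclUT m w))
      - (m.2.1 0 * wedgeL (y 1) (y 2) (dInclUT m v) (dInclUT m w)
        + m.2.1 1 * wedgeL (y 2) (y 0) (dInclUT m v) (dInclUT m w)
        + m.2.1 2 * wedgeL (y 0) (y 1) (dInclUT m v) (dInclUT m w))
    simp only [wedgeL_apply]
    rfl
  · intro m
    obtain ⟨a, b, hdot, hdet⟩ := exists_orthonormal_frame m.2.1 (sum_sq_sphere m)
    let coord (l : Fin 3 → ℝ) (e : Fin 3 → EuclideanSpace ℝ (Fin 3) × EuclideanSpace ℝ (Fin 3)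
        →L[ℝ] ℝ) : TangentSpace modelUT m →ₗ[ℝ] ℝ :=
      (l 0 • e 0 + l 1 • e 1 + l 2 • e 2).toLinearMap ∘ₗ (dInclUT m).toLinearMap
    have hcx (l : Fin 3 → ℝ) (v) : coord l x v = l ⬝ᵥ (dInclUT m v).1 := by
      rw [dotProduct, Fin.sum_univ_three]; rfl
    have hcy (l : Fin 3 → ℝ) (v) : coord l y v = l ⬝ᵥ (dInclUT m v).2 := by
      rw [dotProduct, Fin.sum_univ_three]; rfl
    have horth (v) (hv : thetaUT m v = 0) : (m.2.1 : Fin 3 → ℝ) ⬝ᵥ (dInclUT m v).1 = 0 := by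
      rw [dotProduct, Fin.sum_univ_three, ← thetaUT_apply, hv]
    have horth' (v) : (m.2.1 : Fin 3 → ℝ) ⬝ᵥ (dInclUT m v).2 = 0 := by
      rw [dotProduct, Fin.sum_univ_three, dotProduct_dInclUT_snd]
    -- On `ker θ` both `dx` and `dy` are orthogonal to `y`, so their components along `a, b` serve
    -- as `(x, y, p, q)`. The triple products in `ω` become determinants in the frame, and `dθ = ∑
    -- dy_i ∧ dx_i` is an antisymmetrised scalar product.
    refine ⟨LinearMap.pi ![coord a x, coord b x, coord a y, coord b y], ?_, ?_, ?_⟩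
    · intro v hv hL
      have e0 : coord a x v = 0 := congrFun hL 0
      have e1 : coord b x v = 0 := congrFun hL 1
      have e2 : coord a y v = 0 := congrFun hL 2
      have e3 : coord b y v = 0 := congrFun hL 3
      rw [hcx] at e0 e1
      rw [hcy] at e2 e3
      have h1 := hdot _ (dInclUT m v).1 (horth v hv)
      have h2 := hdot _ (dInclUT m v).2 (horth' v)
      rw [e0, e1, mul_zero, add_zero, dotProduct_self_eq_zero] at h1
      rw [e2, e3, mul_zero, add_zero, dotProduct_self_eq_zero] at h2
      refine (injective_iff_map_eq_zero _).1 (dInclUT_injective m) v ?_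
      refine Prod.ext ?_ ?_
      · ext i; exact congrFun h1 i
      · ext i; exact congrFun h2 i
    · intro v w _ _
      change _ = c * (coord a x v * coord b x w - coord a x w * coord b x v)
        - (coord a y v * coord b y w - coord a y w * coord b y v)
      rw [hcx, hcx, hcx, hcx, hcy, hcy, hcy, hcy, ← hdet, ← hdet]
      exact omegaK_apply c m v w
    · intro v w hv hw
      rw [(hθ' _).fderiv]
      change _ = (coord a y v * coord a x w - coord a y w * coord a x v)
        + (coord b y v * coord b x w - coord b y w * coord b x v)
      rw [hcx, hcx, hcx, hcx, hcy, hcy, hcy, hcy]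
      have h1 := hdot _ (dInclUT m w).1 (horth' v)
      have h2 := hdot _ (dInclUT m v).1 (horth' w)
      have e (v w) : (dInclUT m v).2 ⬝ᵥ (dInclUT m w).1
          = ((y 0).smulRight (x 0) + (y 1).smulRight (x 1) + (y 2).smulRight (x 2))
            (dInclUT m v) (dInclUT m w) := by
        rw [dotProduct, Fin.sum_univ_three]; rfl
      rw [e] at h1 h2
      refine (congrArg₂ (· - ·) h1 h2).trans ?_
      ring

end MongeAmpere

theorem mainTheorem3 (c : ℝ) (hc : c ≠ 0) :
    (∀ f : MongeAmpere.Plane → MongeAmpere.R5,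
      MongeAmpere.IsOpenUmbrella 𝓘(ℝ, MongeAmpere.R5) MongeAmpere.thetaR5 f →
        ¬ MongeAmpere.IsGeneralizedGeometricSolution 𝓘(ℝ, MongeAmpere.R5)
          MongeAmpere.thetaR5 (MongeAmpere.omegaHess c) f) ∧
    (∀ f : MongeAmpere.Plane → MongeAmpere.UnitTangent,
      MongeAmpere.IsOpenUmbrella MongeAmpere.modelUT MongeAmpere.thetaUT f →
        ¬ MongeAmpere.IsGeneralizedGeometricSolution MongeAmpere.modelUT
          MongeAmpere.thetaUT (MongeAmpere.omegaK c) f) :=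
  ⟨fun _ => MongeAmpere.not_isGeneralizedGeometricSolution_hess hc,
    fun _ => MongeAmpere.not_isGeneralizedGeometricSolution_gauss hc⟩
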